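/- **Setting.** There are $N$ agents. Agent $i$ chooses $x_i\in X_i\subseteq\mathbb R^n$; put $X=\prod_{i=1}^N X_i\subseteq\mathbb R^{nN}$. Agent $i$'s uncertainty $\xi_i$ takes values in $\Xi_i\subseteq\mathbb R^p$ and has the true distribution $\mathbb P_i$; its cost is $h_i:\mathbb R^{nN}\times\Xi_i\to\mathbb R$. For a family $Q=(Q_i)_{i=1}^N$ of probability measures $Q_i$ on $\Xi_i$ let $$F_Q(x)=\big(\nabla_{x_i}\mathbb E_{Q_i}[h_i(x_i,x_{-i},\xi_i)]\big)_{i=1}^N,$$ and let $\mathrm{SOL}(X,F)=\{x\in X:\ (y-x)^\top F(x)\ge 0\ \text{for all } y\in X\}$. Say that $Q_i$ has *finite expected cost* if for each $x\in X$ the function $h_i(y,x_{-i},\cdot)$ is $Q_i$-integrable for all $y\in\mathbb R^n$ in a neighbourhood of $x_i$. Let $\mathcal M(\Xi_i)$ be the set of probability measures on $\Xi_i$ with finite first moment, and let $d_W(Q_1,Q_2)=\inf_\Pi\int\|\xi-\xi'\|\,\Pi(d\xi,d\xi')$ be the Wasserstein distance, where $\Pi$ ranges over the joint distributions on $\Xi_i\times\Xi_i$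 with marginals $Q_1,Q_2$. The samples $\xi_i^{(1)},\xi_i^{(2)},\dots$ of agent $i$ are i.i.d. with law $\mathbb P_i$, and independent across agents; $\mathbb P^\infty$ denotes their joint law. Let $\hat{\mathbb P}_{K_i}=\frac1{K_i}\sum_{k=1}^{K_i}\delta_{\xi_i^{(k)}}$, and for $K=(K_i)_{i=1}^N\in\mathbb N^N$ with all $K_i\ge1$ let $$\mathcal W_K(\hat{\mathbb P}_K)=\prod_{i=1}^N\{Q_i\in\mathcal M(\Xi_i):\ d_W(\hat{\mathbb P}_{K_i},Q_i)\le\epsilon_i(K_i,\beta_i^{(K_i)})\},$$ where, for constants $b_i,c_i>0$ and $a_i>1$, $$\epsilon_i(k,\beta)=\begin{cases}\big(\tfrac{\ln(c_i/\beta)}{b_ik}\big)^{1/\max\{p,2\}} & \text{if } k\ge \ln(c_i/\beta)/b_i,\\[2pt] \big(\tfrac{\ln(c_i/\beta)}{b_ik}\big)^{1/a_i}&\text{otherwise.}\end{cases}$$ **Assumptions.** For each $i$: (1) for all $x_{-i}\in X_{-i}$, $h_i(x,\cdot)$ is measurable on $\Xi_i$ for every $x_i\in\mathbb R^n$, and $h_i(\cdot,x_{-i},\xi_i)$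 is continuously differentiable and convex on $\mathbb R^n$ for every $\xi_i\in\Xi_i$; (2) $X_i$ is compact and convex; (3) $\mathbb E_{\mathbb P_i}[\exp(\|\xi_i\|^{a_i})]<\infty$; (4) there are constants $L_{i,j}$ with $\big|\partial h_i(x,\xi)/\partial x_i^{(j)}-\partial h_i(x,\xi')/\partial x_i^{(j)}\big|\le L_{i,j}\|\xi-\xi'\|$ for all $j\in\{1,\dots,n\}$, $x\in X$, $\xi,\xi'\in\Xi_i$; (5) $\mathbb P_i$ has finite expected cost, and the map $F_{\mathbb P}$ is continuous on $X$; (6) $\beta_i^{(k)}\in(0,1)$ for all $k\ge1$, $\sum_{k\ge1}\beta_i^{(k)}<\infty$, and $\lim_{k\to\infty}\epsilon_i(k,\beta_i^{(k)})=0$. **Theorem.** Let $x^*$ be an isolated solution of $\mathrm{VI}(X,F_{\mathbb P})$, with neighbourhood $V$: $V$ is a neighbourhood of $x^*$ and $\mathrm{SOL}(X,F_{\mathbb P})\cap V=\{x^*\}$. Then $\mathbb P^\infty$-almost surely the following holds. Let $S\subseteq\{K\in\mathbb N^N: K_i\ge1\ \forall i\}$ be cofinal, that is, for every $K^0\in\mathbb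 N^N$ there is $K\in S$ with $K_i\ge K_i^0$ for all $i$ (for instance, the set of all such $K$). For each $K\in S$ let $q_K\in\mathcal W_K(\hat{\mathbb P}_K)$ have finite expected costs for all agents, and let $x_K^*\in\mathrm{SOL}(X,F_{q_K})\cap V$. Then, as $K\in S$ and $K_i\to\infty$ for all $i$: * the family $(x_K^*)_{K\in S}$ has at least one accumulation point; * every accumulation point $\bar x$ of it solves the nominal problem, $\bar x\in\mathrm{SOL}(X,F_{\mathbb P})$; * if $x^*$ is the only solution of $\mathrm{VI}(X,F_{\mathbb P})$ in the closure of $V$ (in particular, if $V$ is closed), then $x_K^*\to x^*$. Here $\bar x$ is an accumulation point if for every neighbourhood $U$ of $\bar x$ and every $K^0\in\mathbb N^N$ there is $K\in S$ with $K\ge K^0$ componentwise and $x_K^*\in U$. -/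

import Mathlib

open MeasureTheory Filter Topology
open scoped ENNReal

namespace WDRGame

/-- `ℝ^d` with the Euclidean norm. -/
abbrev Vec (d : ℕ) : Type := EuclideanSpace ℝ (Fin d)

/-- Joint decisions `x = (x_1, …, x_N)` with `x_i ∈ ℝ^n`, i.e. the space `ℝ^{nN}`
(only its vector space structure and its topology are used). -/
abbrev Profile (N n : ℕ) : Type := Fin N → Vec n

/-- The costs `h_i : ℝ^{nN} × Ξ_i → ℝ` of the `N` agents, where `Ξ_i ⊆ ℝ^p`. -/
abbrev Costs (N n p : ℕ) (Ξ : Fin N → Set (Vec p)) : Type :=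
  (i : Fin N) → Profile N n → Ξ i → ℝ

/-- The joint feasible set `X = ∏ i, X_i`. -/
def jointSet {N n : ℕ} (X : Fin N → Set (Vec n)) : Set (Profile N n) :=
  {x | ∀ i, x i ∈ X i}

/-- The solution set of the variational inequality `VI(X, F)`: the points `x ∈ X` such that
`(y - x)ᵀ F(x) ≥ 0` for all `y ∈ X`. -/
noncomputable def SOL {N n : ℕ} (X : Set (Profile N n)) (F : Profile N n → Profile N n) :
    Set (Profile N n) :=
  {x | x ∈ X ∧ ∀ y ∈ X, 0 ≤ ∑ i, inner ℝ (y i - x i) (F x i)}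

/-- The function `y ↦ h_i(y, x_{-i}, ξ)` of agent `i`'s own decision. -/
def ownCost {N n p : ℕ} {Ξ : Fin N → Set (Vec p)} (h : Costs N n p Ξ) (i : Fin N)
    (x : Profile N n) (ξ : Ξ i) : Vec n → ℝ :=
  fun y => h i (Function.update x i y) ξ

/-- The pseudogradient `F_Q(x) = (∇_{x_i} E_{Q_i}[h_i(x_i, x_{-i}, ξ_i)])_i`. -/
noncomputable def pseudogradient {N n p : ℕ} {Ξ : Fin N → Set (Vec p)} (h : Costs N n p Ξ)
    (Q : (i : Fin N) → Measure (Ξ i)) (x : Profile N n) : Profile N n :=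
  fun i => gradient (fun y => ∫ ξ, ownCost h i x ξ y ∂(Q i)) (x i)

/-- Agent `i`'s expected cost under `Q` is well defined and finite in a neighbourhood (in `x_i`)
of every joint feasible decision, so that its gradient in `x_i` is meaningful there. -/
def FiniteExpectedCost {N n p : ℕ} {Ξ : Fin N → Set (Vec p)} (X : Fin N → Set (Vec n))
    (h : Costs N n p Ξ) (i : Fin N) (Q : Measure (Ξ i)) : Prop :=
  ∀ x ∈ jointSet X, ∀ᶠ y in 𝓝 (x i), Integrable (fun ξ => ownCost h i x ξ y) Q

/-- Each `h_i` is measurable in `ξ_i` and continuously differentiable in `x_i`, for `x_{-i}`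
in `X_{-i}`. -/
def SmoothCosts {N n p : ℕ} {Ξ : Fin N → Set (Vec p)} (X : Fin N → Set (Vec n))
    (h : Costs N n p Ξ) : Prop :=
  ∀ i, ∀ x : Profile N n, (∀ j, j ≠ i → x j ∈ X j) →
    Measurable (h i x) ∧ ∀ ξ, ContDiff ℝ 1 (ownCost h i x ξ)

/-- Each `X_i` is compact and convex and each `h_i` is convex in `x_i`, for `x_{-i}`
in `X_{-i}`. -/
def ConvexGame {N n p : ℕ} {Ξ : Fin N → Set (Vec p)} (X : Fin N → Set (Vec n))
    (h : Costs N n p Ξ) : Prop :=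
  (∀ i, IsCompact (X i) ∧ Convex ℝ (X i)) ∧
  ∀ i, ∀ x : Profile N n, (∀ j, j ≠ i → x j ∈ X j) →
    ∀ ξ, ConvexOn ℝ Set.univ (ownCost h i x ξ)

/-- The partial derivatives `∂h_i / ∂x_i^{(j)}` are `L i j`-Lipschitz in `ξ_i`, for all `x ∈ X`. -/
def LipschitzPartials {N n p : ℕ} {Ξ : Fin N → Set (Vec p)} (X : Fin N → Set (Vec n))
    (h : Costs N n p Ξ) (L : Fin N → Fin n → ℝ) : Prop :=
  ∀ i j, ∀ x ∈ jointSet X, ∀ ξ ξ' : Ξ i,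
    |gradient (ownCost h i x ξ) (x i) j - gradient (ownCost h i x ξ') (x i) j|
      ≤ L i j * ‖(ξ : Vec p) - (ξ' : Vec p)‖

/-- The light-tail condition `E_Q[exp(‖ξ‖^a)] < ∞`, with `a > 1`. -/
def LightTail {p : ℕ} {Ξ : Set (Vec p)} (Q : Measure Ξ) (a : ℝ) : Prop :=
  1 < a ∧ Integrable (fun ξ : Ξ => Real.exp (‖(ξ : Vec p)‖ ^ a)) Q

/-- `𝓜(Ξ)`: the probability distributions on `Ξ` with a finite first moment. -/
def FiniteMean {p : ℕ} (Ξ : Set (Vec p)) : Set (Measure Ξ) :=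
  {Q | IsProbabilityMeasure Q ∧ Integrable (fun ξ : Ξ => ‖(ξ : Vec p)‖) Q}

/-- The Wasserstein distance: the infimum of `∫ ‖ξ₁ - ξ₂‖ dΠ` over all joint distributions `Π`
on `Ξ × Ξ` with marginals `Q₁` and `Q₂`. -/
noncomputable def dW {p : ℕ} {Ξ : Set (Vec p)} (Q₁ Q₂ : Measure Ξ) : ℝ≥0∞ :=
  ⨅ π ∈ {π : Measure (Ξ × Ξ) | IsProbabilityMeasure π ∧ π.map Prod.fst = Q₁ ∧
      π.map Prod.snd = Q₂},
    ∫⁻ z, ENNReal.ofReal ‖(z.1 : Vec p) - (z.2 : Vec p)‖ ∂π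

/-- The Wasserstein ball of radius `ε` around `P`. -/
def wassersteinBall {p : ℕ} {Ξ : Set (Vec p)} (P : Measure Ξ) (ε : ℝ) : Set (Measure Ξ) :=
  {Q | Q ∈ FiniteMean Ξ ∧ dW P Q ≤ ENNReal.ofReal ε}

/-- The empirical distribution of the first `K` samples (used for `K ≥ 1`). -/
noncomputable def empirical {α : Type*} [MeasurableSpace α] (s : ℕ → α) (K : ℕ) : Measure α :=
  (K : ℝ≥0∞)⁻¹ • ∑ k ∈ Finset.range K, Measure.dirac (s k)

/-- The law `𝐏^∞` of the samples: for each agent `i` an infinite sequence of independent samples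
from `P_i`, independent across the agents. -/
noncomputable def samplingLaw {N p : ℕ} {Ξ : Fin N → Set (Vec p)}
    (P : (i : Fin N) → Measure (Ξ i)) [∀ i, IsProbabilityMeasure (P i)] :
    Measure ((i : Fin N) → ℕ → Ξ i) :=
  Measure.pi fun i => Measure.infinitePi fun _ : ℕ => P i

/-- The radius `ε(K, β)` that belongs to the sample size `K` and the confidence parameter `β`,
with constants `c, b`, tail exponent `a` and dimension `p`. -/
noncomputable def radius (p : ℕ) (a b c : ℝ) (K : ℕ) (β : ℝ) : ℝ :=
  if Real.log (c / β) / b ≤ (K : ℝ) then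
    (Real.log (c / β) / (b * K)) ^ (1 / max (p : ℝ) 2)
  else
    (Real.log (c / β) / (b * K)) ^ (1 / a)

end WDRGame

/-!
The pseudogradient is an expectation, `F_Q(x)_i = E_{Q_i}[∇_{x_i} h_i(x, ξ_i)]`: convexity of `h_i`
and integrability of the costs near `x_i` give an integrable local Lipschitz constant, hence
differentiation under the integral (`hasGradientAt_integral_of_convexOn`,
`pseudogradient_eq_integral`). The integrand is Lipschitz in `ξ_i` with a constant that does not
depend on `x ∈ X`. Passing from a distribution in the Wasserstein ball to the empirical distribution
therefore costs at most this constant times the radius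
(`enorm_integral_sub_integral_le_mul_dW`), and passing from the empirical to the true distribution
costs an amount that almost surely tends to zero, uniformly over Lipschitz integrands
(`ae_eventually_norm_integral_empirical_sub_le`). So `F_{q_K} - F_P` tends to zero uniformly on `X`
(`tendsto_pseudogradient_sub`).

This uniform law of large numbers
comes from the strong law for countably many functions: a sequence of simple maps `T_m` approximates
the identity in `L¹(P_i)`, and for a fixed `m` only the mean displacement of `T_m` and the masses of
its finitely many fibres have to converge. The light tail makes the first
moment finite, so that the displacement is integrable.

The rest is the stability of variational inequalities on the compact set `X` with continuous `F_P`
(`mem_SOL_of_mapClusterPt`): accumulation points exist and solve the nominal problem, and if the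
only solution in the closure of `V` is `xstar`, then it is the only accumulation point, so that the
family converges.
-/

namespace WDRGame

open scoped NNReal

/-! ### Integrals of Lipschitz functions -/

theorem integral_comp_simpleFunc {α E : Type*} [MeasurableSpace α] [NormedAddCommGroup E]
    [NormedSpace ℝ E] [CompleteSpace E] (T : SimpleFunc α α) (f : α → E) (μ : Measure α)
    [IsFiniteMeasure μ] :
    ∫ ξ, f (T ξ) ∂μ = ∑ v ∈ T.range, μ.real (T ⁻¹' {v}) • f v := by
  classical
  have hsum : ∀ ξ, f (T ξ) = ∑ v ∈ T.range, (T ⁻¹' {v}).indicator (fun _ => f v) ξ := by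
    intro ξ
    rw [Finset.sum_eq_single (T ξ)]
    · simp
    · intro v _ hv
      simp [Set.indicator, hv.symm]
    · intro h
      exact absurd (T.mem_range_self ξ) h
  simp_rw [hsum]
  rw [integral_finsetSum]
  · refine Finset.sum_congr rfl fun v _ => ?_
    rw [integral_indicator_const _ (T.measurableSet_fiber v)]
  · intro v _
    exact (integrable_const _).indicator (T.measurableSet_fiber v)

section Lipschitz

variable {α E : Type*} [MetricSpace α] [SecondCountableTopology α] [MeasurableSpace α]
  [BorelSpace α] [NormedAddCommGroup E]

theorem integrable_of_lipschitzWith {C : ℝ≥0} {f : α → E} (hf : LipschitzWith C f)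
    {μ : Measure α} [IsFiniteMeasure μ] {z : α} (hμ : Integrable (fun ξ => dist ξ z) μ) :
    Integrable f μ := by
  refine Integrable.mono' ((hμ.const_mul C).add (integrable_const ‖f z‖))
    hf.continuous.aestronglyMeasurable (ae_of_all _ fun ξ => ?_)
  have h1 := hf.dist_le_mul ξ z
  rw [dist_eq_norm] at h1
  have h2 := norm_sub_norm_le (f ξ) (f z)
  simp only [Pi.add_apply]
  linarith

/-- Two probability measures integrate all `C`-Lipschitz functions almost alike, uniformly, once the
simple function `T` moves points little on average under both and they give nearly the same mass to
each of the finitely many fibres of `T`. -/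
theorem norm_integral_sub_integral_le_of_simpleFunc [NormedSpace ℝ E] [CompleteSpace E]
    {C : ℝ≥0} {f : α → E} (hf : LipschitzWith C f)
    {μ ν : Measure α} [IsProbabilityMeasure μ] [IsProbabilityMeasure ν] {z : α}
    (hμ : Integrable (fun ξ => dist ξ z) μ) (hν : Integrable (fun ξ => dist ξ z) ν)
    (T : SimpleFunc α α) :
    ‖∫ ξ, f ξ ∂μ - ∫ ξ, f ξ ∂ν‖ ≤ C * (∫ ξ, dist ξ (T ξ) ∂μ + ∫ ξ, dist ξ (T ξ) ∂ν
      + ∑ v ∈ T.range, |μ.real (T ⁻¹' {v}) - ν.real (T ⁻¹' {v})| * dist v z) := by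
  have hTint : ∀ (κ : Measure α) [IsFiniteMeasure κ], Integrable (fun ξ => f (T ξ)) κ :=
    fun κ _ => (T.map f).integrable_of_isFiniteMeasure
  have hTz : ∀ (κ : Measure α) [IsFiniteMeasure κ], Integrable (fun ξ => dist (T ξ) z) κ :=
    fun κ _ => (T.map fun y => dist y z).integrable_of_isFiniteMeasure
  have key : ∀ (κ : Measure α) [IsFiniteMeasure κ], Integrable (fun ξ => dist ξ z) κ →
      ‖∫ ξ, f ξ ∂κ - ∫ ξ, f (T ξ) ∂κ‖ ≤ C * ∫ ξ, dist ξ (T ξ) ∂κ := by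
    intro κ _ hκ
    have hd : Integrable (fun ξ => dist ξ (T ξ)) κ := by
      refine Integrable.mono' (hκ.add (hTz κ)) ?_ (ae_of_all _ fun ξ => ?_)
      · exact (measurable_id.dist T.measurable).aestronglyMeasurable
      · simpa using dist_triangle_right ξ (T ξ) z
    rw [← integral_sub (integrable_of_lipschitzWith hf hκ) (hTint κ), ← integral_const_mul]
    refine norm_integral_le_of_norm_le (hd.const_mul _) (ae_of_all _ fun ξ => ?_)
    rw [← dist_eq_norm]
    exact hf.dist_le_mul _ _
  have hone : ∀ (κ : Measure α) [IsProbabilityMeasure κ],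
      ∑ v ∈ T.range, κ.real (T ⁻¹' {v}) = 1 := by
    intro κ _
    simpa using (integral_comp_simpleFunc T (fun _ => (1 : ℝ)) κ).symm
  have hmid : ‖∫ ξ, f (T ξ) ∂μ - ∫ ξ, f (T ξ) ∂ν‖ ≤
      C * ∑ v ∈ T.range, |μ.real (T ⁻¹' {v}) - ν.real (T ⁻¹' {v})| * dist v z := by
    -- both measures have total mass one, so `f` may be normalised to vanish at `z`
    have heq : ∫ ξ, f (T ξ) ∂μ - ∫ ξ, f (T ξ) ∂ν =
        ∑ v ∈ T.range, (μ.real (T ⁻¹' {v}) - ν.real (T ⁻¹' {v})) • (f v - f z) := by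
      simp only [sub_smul, smul_sub, Finset.sum_sub_distrib, ← Finset.sum_smul, hone,
        integral_comp_simpleFunc]
      abel
    rw [heq, Finset.mul_sum]
    refine norm_sum_le_of_le _ fun v _ => ?_
    rw [norm_smul, Real.norm_eq_abs, mul_left_comm]
    gcongr
    rw [← dist_eq_norm]
    exact hf.dist_le_mul _ _
  have h1 := key μ hμ
  have h2 := key ν hν
  rw [norm_sub_rev] at h2
  have h3 := norm_add₃_le (a := ∫ ξ, f ξ ∂μ - ∫ ξ, f (T ξ) ∂μ)
    (b := ∫ ξ, f (T ξ) ∂μ - ∫ ξ, f (T ξ) ∂ν) (c := ∫ ξ, f (T ξ) ∂ν - ∫ ξ, f ξ ∂ν)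
  rw [sub_add_sub_cancel, sub_add_sub_cancel] at h3
  linarith

end Lipschitz

/-! ### The law of large numbers, uniformly over Lipschitz functions -/

section Empirical

variable {α E : Type*} [MeasurableSpace α] [NormedAddCommGroup E]

theorem isProbabilityMeasure_empirical (s : ℕ → α) {k : ℕ} (hk : k ≠ 0) :
    IsProbabilityMeasure (empirical s k) := by
  constructor
  simp only [empirical, Measure.smul_apply, Measure.coe_finsetSum, Finset.sum_apply,
    measure_univ, Finset.sum_const, Finset.card_range, smul_eq_mul, nsmul_eq_mul, mul_one]
  exact ENNReal.inv_mul_cancel (by simpa using hk) (by simp)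

theorem integrable_empirical [MeasurableSingletonClass α] (s : ℕ → α) {k : ℕ} (hk : k ≠ 0)
    (g : α → E) : Integrable g (empirical s k) := by
  refine Integrable.smul_measure ?_ (by simpa using hk)
  exact integrable_finsetSum_measure.2 fun j _ => integrable_dirac (by simp)

theorem integral_empirical [MeasurableSingletonClass α] [NormedSpace ℝ E] [CompleteSpace E]
    (s : ℕ → α) (k : ℕ) (g : α → E) : ∫ ξ, g ξ ∂(empirical s k) = (k : ℝ)⁻¹ • ∑ j ∈ Finset.range k, g (s j) := by
  rw [empirical, integral_smul_measure, integral_finsetSum_measure]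
  · simp
  · intro j _
    exact integrable_dirac (by simp)

theorem ae_tendsto_integral_empirical [MeasurableSingletonClass α] {P : Measure α}
    [IsProbabilityMeasure P] {g : α → ℝ} (hgm : Measurable g) (hg : Integrable g P) :
    ∀ᵐ s ∂(Measure.infinitePi fun _ : ℕ => P),
      Tendsto (fun k => ∫ ξ, g ξ ∂(empirical s k)) atTop (𝓝 (∫ ξ, g ξ ∂P)) := by
  have hmp : ∀ j : ℕ, MeasurePreserving (Function.eval j)
      (Measure.infinitePi fun _ : ℕ => P) P := fun j =>
    measurePreserving_eval_infinitePi (fun _ : ℕ => P) j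
  have hlaw := ProbabilityTheory.strong_law_ae (μ := Measure.infinitePi fun _ : ℕ => P)
    (fun j s => g (s j))
    ((hmp 0).integrable_comp_of_integrable hg)
    (fun j k hjk => (ProbabilityTheory.iIndepFun_infinitePi (P := fun _ : ℕ => P)
      (X := fun _ => g) fun _ => hgm).indepFun hjk)
    (fun j => by
      refine ⟨?_, ?_, ?_⟩
      · exact (hgm.comp (measurable_pi_apply j)).aemeasurable
      · exact (hgm.comp (measurable_pi_apply 0)).aemeasurable
      · have : ∀ j : ℕ, Measure.map (fun s : ℕ → α => g (s j))
            (Measure.infinitePi fun _ : ℕ => P) = Measure.map g P := by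
          intro j
          have h := Measure.map_map (μ := Measure.infinitePi fun _ : ℕ => P) hgm (hmp j).measurable
          rw [(hmp j).map_eq] at h
          exact h.symm
        rw [this, this])
  have hexp : ∫ s, g (s 0) ∂(Measure.infinitePi fun _ : ℕ => P) = ∫ ξ, g ξ ∂P := by
    have h := integral_map (μ := Measure.infinitePi fun _ : ℕ => P)
      (hmp 0).measurable.aemeasurable hgm.aestronglyMeasurable
    rw [(hmp 0).map_eq] at h
    exact h.symm
  filter_upwards [hlaw] with s hs
  simp_rw [integral_empirical]
  rwa [hexp] at hs

variable [MetricSpace α] [SecondCountableTopology α] [BorelSpace α]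

theorem exists_simpleFunc_tendsto_integral_dist {P : Measure α} {z : α}
    (hP : Integrable (fun ξ => dist ξ z) P) :
    ∃ T : ℕ → SimpleFunc α α, (∀ m, Integrable (fun ξ => dist ξ (T m ξ)) P) ∧
      Tendsto (fun m => ∫ ξ, dist ξ (T m ξ) ∂P) atTop (𝓝 0) := by
  set T : ℕ → SimpleFunc α α :=
    fun m => SimpleFunc.approxOn id measurable_id Set.univ z (Set.mem_univ z) m with hT
  -- `approxOn` never moves a point further than its distance to the base point `z`
  have hbound : ∀ m ξ, ‖dist ξ (T m ξ)‖ ≤ dist ξ z := by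
    intro m ξ
    have := SimpleFunc.edist_approxOn_le measurable_id (Set.mem_univ z) ξ m
    rw [edist_dist, edist_dist, ENNReal.ofReal_le_ofReal_iff dist_nonneg] at this
    rw [Real.norm_of_nonneg dist_nonneg, dist_comm, dist_comm ξ z]
    exact this
  have hmeas : ∀ m, AEStronglyMeasurable (fun ξ => dist ξ (T m ξ)) P := fun m =>
    (measurable_id.dist (T m).measurable).aestronglyMeasurable
  refine ⟨T, fun m => hP.mono' (hmeas m) (ae_of_all _ (hbound m)), ?_⟩
  have := tendsto_integral_of_dominated_convergence (F := fun m ξ => dist ξ (T m ξ))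
    (f := fun _ => (0 : ℝ)) (μ := P) (fun ξ => dist ξ z) hmeas hP
    (fun m => ae_of_all _ (hbound m)) (ae_of_all _ fun ξ => by
      have h := SimpleFunc.tendsto_approxOn measurable_id (Set.mem_univ z)
        (x := ξ) (by simp)
      simpa using tendsto_const_nhds.dist h (a := ξ))
  simpa using this

/-- A uniform law of large numbers: almost surely, the empirical integrals of all `C`-Lipschitz
functions converge at a common rate. By duality this is convergence of the empirical measures in
the Wasserstein distance; only the strong law for countably many fixed functions enters. -/
theorem ae_eventually_norm_integral_empirical_sub_le (E : Type*) [NormedAddCommGroup E]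
    [NormedSpace ℝ E] [CompleteSpace E] {P : Measure α} [IsProbabilityMeasure P] {z : α}
    (hP : Integrable (fun ξ => dist ξ z) P) :
    ∀ᵐ s ∂(Measure.infinitePi fun _ : ℕ => P), ∀ η > 0, ∀ᶠ k in atTop,
      ∀ (C : ℝ≥0) (f : α → E), LipschitzWith C f →
        ‖∫ ξ, f ξ ∂(empirical s k) - ∫ ξ, f ξ ∂P‖ ≤ C * η := by
  obtain ⟨T, hTint, hT⟩ := exists_simpleFunc_tendsto_integral_dist hP
  have h1 : ∀ᵐ s ∂(Measure.infinitePi fun _ : ℕ => P), ∀ m,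
      Tendsto (fun k => ∫ ξ, dist ξ (T m ξ) ∂(empirical s k)) atTop
        (𝓝 (∫ ξ, dist ξ (T m ξ) ∂P)) :=
    ae_all_iff.2 fun m => ae_tendsto_integral_empirical
      (measurable_id.dist (T m).measurable) (hTint m)
  have h2 : ∀ᵐ s ∂(Measure.infinitePi fun _ : ℕ => P), ∀ m, ∀ v ∈ (T m).range,
      Tendsto (fun k => (empirical s k).real (T m ⁻¹' {v})) atTop
        (𝓝 (P.real (T m ⁻¹' {v}))) := by
    refine ae_all_iff.2 fun m => (ae_ball_iff (T m).range.countable_toSet).2 fun v _ => ?_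
    have hv := (T m).measurableSet_fiber v
    filter_upwards [ae_tendsto_integral_empirical (P := P) (measurable_const.indicator hv)
      ((integrable_const (1 : ℝ)).indicator hv)] with s hs
    simpa [integral_indicator_const _ hv] using hs
  filter_upwards [h1, h2] with s hs1 hs2 η hη
  obtain ⟨m, hm⟩ := (hT.eventually_lt_const (show (0 : ℝ) < η / 2 by positivity)).exists
  have hlim : Tendsto (fun k => ∫ ξ, dist ξ (T m ξ) ∂(empirical s k) + ∫ ξ, dist ξ (T m ξ) ∂P
      + ∑ v ∈ (T m).range,
        |(empirical s k).real (T m ⁻¹' {v}) - P.real (T m ⁻¹' {v})| * dist v z) atTop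
      (𝓝 (∫ ξ, dist ξ (T m ξ) ∂P + ∫ ξ, dist ξ (T m ξ) ∂P + ∑ v ∈ (T m).range,
        |P.real (T m ⁻¹' {v}) - P.real (T m ⁻¹' {v})| * dist v z)) :=
    ((hs1 m).add_const _).add (tendsto_finsetSum _ fun v hv =>
      ((hs2 m v hv).sub_const _).abs.mul_const _)
  simp only [sub_self, abs_zero, zero_mul, Finset.sum_const_zero, add_zero] at hlim
  filter_upwards [hlim.eventually_lt_const (show _ < η by linarith), eventually_ne_atTop 0]
    with k hk hk0 C f hf
  have := isProbabilityMeasure_empirical s hk0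
  refine (norm_integral_sub_integral_le_of_simpleFunc hf (integrable_empirical s hk0 _) hP
    (T m)).trans ?_
  gcongr

end Empirical

/-! ### The Wasserstein distance -/

/-- The elementary half of Kantorovich duality: any coupling bounds the difference of the
integrals of a Lipschitz function. -/
theorem enorm_integral_sub_integral_le_mul_dW {p : ℕ} {Ξ : Set (Vec p)} {E : Type*}
    [NormedAddCommGroup E] [NormedSpace ℝ E] {C : ℝ≥0} (hC : C ≠ 0) {f : Ξ → E}
    (hf : LipschitzWith C f) {P Q : Measure Ξ} (hP : Integrable f P) (hQ : Integrable f Q) :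
    ‖∫ ξ, f ξ ∂P - ∫ ξ, f ξ ∂Q‖ₑ ≤ C * dW P Q := by
  rw [dW]
  simp only [ENNReal.mul_iInf_of_ne (ENNReal.coe_ne_zero.2 hC) ENNReal.coe_ne_top]
  refine le_iInf₂ fun π hπ => ?_
  obtain ⟨-, rfl, rfl⟩ := hπ
  rw [integral_map measurable_fst.aemeasurable hP.1, integral_map measurable_snd.aemeasurable hQ.1,
    ← integral_sub (f := fun w : Ξ × Ξ => f w.1) (g := fun w : Ξ × Ξ => f w.2)
      (hP.comp_measurable measurable_fst) (hQ.comp_measurable measurable_snd),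
    ← lintegral_const_mul' _ _ ENNReal.coe_ne_top]
  refine (enorm_integral_le_lintegral_enorm _).trans (lintegral_mono fun w => ?_)
  have := hf.edist_le_mul w.1 w.2
  rwa [edist_eq_enorm_sub, Subtype.edist_eq, edist_dist, dist_eq_norm] at this

/-! ### Differentiating expected convex costs -/

/-- If the convex functions `g · ξ` are integrable in `ξ` at all points near `u`, they are Lipschitz
near `u` with an integrable constant. A simplex around `u` whose vertices lie in the region of
integrability bounds `g · ξ` above by its values at the vertices; reflection in `u` bounds it
below. -/
theorem exists_lipschitzOnWith_of_convexOn {E α : Type*} [NormedAddCommGroup E]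
    [NormedSpace ℝ E] [FiniteDimensional ℝ E] [MeasurableSpace α] {Q : Measure α}
    {g : E → α → ℝ} {u : E} (hconv : ∀ ξ, ConvexOn ℝ Set.univ fun y => g y ξ)
    (hint : ∀ᶠ y in 𝓝 u, Integrable (g y) Q) :
    ∃ s ∈ 𝓝 u, ∃ B : α → ℝ, Integrable B Q ∧
      ∀ ξ, LipschitzOnWith (Real.nnabs (B ξ)) (fun y => g y ξ) s := by
  obtain ⟨b, hb, hbs⟩ := exists_mem_interior_convexHull_affineBasis hint
  obtain ⟨r, hr, hball⟩ := Metric.mem_nhds_iff.1 (mem_interior_iff_mem_nhds.1 hb)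
  set M : α → ℝ := fun ξ => ∑ j, |g (b j) ξ| + 2 * |g u ξ| with hM
  have hMint : Integrable M Q := by
    refine (integrable_finsetSum _ fun j _ => ?_).add (Integrable.const_mul ?_ _)
    · exact Integrable.abs (hbs (subset_convexHull ℝ _ (Set.mem_range_self j)))
    · exact Integrable.abs (hint.self_of_nhds)
  refine ⟨Metric.ball u (r - r / 2), Metric.ball_mem_nhds _ (by linarith),
    fun ξ => 2 * M ξ / (r / 2), (hMint.const_mul 2).div_const _, fun ξ => ?_⟩
  have hup : ∀ y ∈ Metric.ball u r, g y ξ ≤ ∑ j, |g (b j) ξ| := by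
    intro y hy
    obtain ⟨_, ⟨j, rfl⟩, hj⟩ := (hconv ξ).exists_ge_of_mem_convexHull
      (Set.subset_univ _) (hball hy)
    exact hj.trans ((le_abs_self _).trans
      (Finset.single_le_sum (f := fun j => |g (b j) ξ|) (fun _ _ => abs_nonneg _)
        (Finset.mem_univ j)))
  have hMξ : ∀ y, dist y u < r → |g y ξ| ≤ M ξ := by
    intro y hy
    -- the reflection of `y` in `u` turns the upper bound into a lower one
    have hy' : (2 : ℝ) • u - y ∈ Metric.ball u r := by
      rw [Metric.mem_ball, dist_eq_norm]
      rw [dist_eq_norm, norm_sub_rev] at hy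
      rwa [show (2 : ℝ) • u - y - u = u - y by module]
    have hmid := (hconv ξ).2 (Set.mem_univ y) (Set.mem_univ ((2 : ℝ) • u - y))
      (show (0 : ℝ) ≤ 1 / 2 by norm_num) (show (0 : ℝ) ≤ 1 / 2 by norm_num) (by norm_num)
    have hu : (1 / 2 : ℝ) • y + (1 / 2 : ℝ) • ((2 : ℝ) • u - y) = u := by module
    simp only [hu, smul_eq_mul] at hmid
    have h1 := hup y hy
    have h2 := hup _ hy'
    have h3 := neg_abs_le (g u ξ)
    have h4 := abs_nonneg (g u ξ)
    rw [abs_le]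
    constructor <;> simp only [hM] <;> linarith
  have hM0 : 0 ≤ M ξ := (abs_nonneg _).trans (hMξ u (by simpa using hr))
  have := ((hconv ξ).subset (Set.subset_univ _) (convex_ball u r)).lipschitzOnWith_of_abs_le
    (half_pos hr) hMξ
  rwa [← Real.nnabs_of_nonneg (by positivity)] at this

/-- For convex integrands, integrability near the point already permits differentiation under the
integral sign. -/
theorem hasGradientAt_integral_of_convexOn {E α : Type*} [NormedAddCommGroup E]
    [InnerProductSpace ℝ E] [FiniteDimensional ℝ E] [MeasurableSpace α] {Q : Measure α}
    {g : E → α → ℝ} {g' : α → E} {u : E} (hconv : ∀ ξ, ConvexOn ℝ Set.univ fun y => g y ξ)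
    (hint : ∀ᶠ y in 𝓝 u, Integrable (g y) Q) (hmeas : AEStronglyMeasurable g' Q)
    (hgrad : ∀ ξ, HasGradientAt (fun y => g y ξ) (g' ξ) u) :
    Integrable g' Q ∧ HasGradientAt (fun y => ∫ ξ, g y ξ ∂Q) (∫ ξ, g' ξ ∂Q) u := by
  obtain ⟨s, hs, B, hB, hlip⟩ := exists_lipschitzOnWith_of_convexOn hconv hint
  set D := (InnerProductSpace.toDual ℝ E).toContinuousLinearEquiv with hD
  have h := hasFDerivAt_integral_of_dominated_loc_of_lip (𝕜 := ℝ) (F := g)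
    (F' := fun ξ => D (g' ξ)) hs (hint.mono fun y hy => hy.1) (hint.self_of_nhds)
    (D.continuous.comp_aestronglyMeasurable hmeas) (ae_of_all _ hlip) hB
    (ae_of_all _ fun ξ => (hgrad ξ).hasFDerivAt)
  have hg' : Integrable g' Q := by
    simpa using D.symm.toContinuousLinearMap.integrable_comp h.1
  refine ⟨hg', ?_⟩
  rw [hasGradientAt_iff_hasFDerivAt]
  have h2 := h.2
  rw [ContinuousLinearEquiv.integral_comp_comm] at h2
  exact h2

/-! ### Pseudogradients as expected gradients -/

section Game

variable {N n p : ℕ} {X : Fin N → Set (Vec n)} {Ξ : Fin N → Set (Vec p)} {h : Costs N n p Ξ}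
  {L : Fin N → Fin n → ℝ}

/-- The partial gradient `∇_{x_i} h_i(x, ξ)`. -/
noncomputable def costGradient (h : Costs N n p Ξ) (i : Fin N) (x : Profile N n) (ξ : Ξ i) :
    Vec n :=
  gradient (ownCost h i x ξ) (x i)

/-- The summand `1` keeps the Lipschitz constant nonzero, which
`enorm_integral_sub_integral_le_mul_dW` requires. -/
theorem lipschitzWith_costGradient (hLip : LipschitzPartials X h L) (i : Fin N)
    {x : Profile N n} (hx : x ∈ jointSet X) :
    LipschitzWith (1 + ∑ j, Real.nnabs (L i j)) (costGradient h i x) := by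
  refine LipschitzWith.of_dist_le_mul fun ξ ξ' => ?_
  rw [dist_eq_norm, Subtype.dist_eq, dist_eq_norm]
  have hd := norm_nonneg ((ξ : Vec p) - (ξ' : Vec p))
  calc ‖costGradient h i x ξ - costGradient h i x ξ'‖
      = ‖∑ j, EuclideanSpace.single j ((costGradient h i x ξ - costGradient h i x ξ') j)‖ := by
        congr 1
        ext k
        simp
    _ ≤ ∑ j, |L i j| * ‖(ξ : Vec p) - (ξ' : Vec p)‖ := by
        refine norm_sum_le_of_le _ fun j _ => ?_
        rw [PiLp.norm_single, Real.norm_eq_abs]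
        refine (hLip i j x hx ξ ξ').trans ?_
        gcongr
        exact le_abs_self _
    _ ≤ _ := by
        rw [← Finset.sum_mul]
        gcongr
        push_cast
        simp

theorem pseudogradient_eq_integral (hsmooth : SmoothCosts X h) (hconvex : ConvexGame X h)
    (hLip : LipschitzPartials X h L) {Q : (i : Fin N) → Measure (Ξ i)} {i : Fin N}
    (hfin : FiniteExpectedCost X h i (Q i)) {x : Profile N n} (hx : x ∈ jointSet X) :
    Integrable (costGradient h i x) (Q i) ∧
      pseudogradient h Q x i = ∫ ξ, costGradient h i x ξ ∂(Q i) := by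
  have hx' : ∀ j, j ≠ i → x j ∈ X j := fun j _ => hx j
  have key := hasGradientAt_integral_of_convexOn (g := fun y ξ => ownCost h i x ξ y)
    (g' := costGradient h i x) (u := x i) (Q := Q i)
    (fun ξ => hconvex.2 i x hx' ξ) (hfin x hx)
    (lipschitzWith_costGradient hLip i hx).continuous.aestronglyMeasurable
    (fun ξ => (((hsmooth i x hx').2 ξ).differentiable one_ne_zero _).hasGradientAt)
  exact ⟨key.1, key.2.gradient⟩

/-! ### Stability of the variational inequality -/

theorem isCompact_jointSet (hX : ∀ i, IsCompact (X i)) : IsCompact (jointSet X) := by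
  simpa [jointSet, Set.pi] using isCompact_univ_pi hX

/-- Stability of variational inequalities: `F` is continuous on `Y`, and the perturbed maps `G k`
need only approach `F` along the perturbed solutions themselves. -/
theorem mem_SOL_of_mapClusterPt {ι : Type*} {l : Filter ι} {Y : Set (Profile N n)}
    (hY : IsClosed Y) {F : Profile N n → Profile N n} (hF : ContinuousOn F Y)
    {G : ι → Profile N n → Profile N n} {x : ι → Profile N n} {xbar : Profile N n}
    (hx : ∀ᶠ k in l, x k ∈ SOL Y (G k))
    (hG : Tendsto (fun k => G k (x k) - F (x k)) l (𝓝 0)) (hbar : MapClusterPt xbar l x) :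
    xbar ∈ SOL Y F := by
  obtain ⟨u, hul, hu⟩ := mapClusterPt_iff_ultrafilter.1 hbar
  have hxu := hx.filter_mono hul
  have hmem : xbar ∈ Y := hY.mem_of_tendsto hu (hxu.mono fun k hk => hk.1)
  refine ⟨hmem, fun y hy => ?_⟩
  have hFu : Tendsto (fun k => F (x k)) u (𝓝 (F xbar)) :=
    (hF xbar hmem).tendsto.comp
      (tendsto_nhdsWithin_iff.2 ⟨hu, hxu.mono fun k hk => hk.1⟩)
  have hGu : Tendsto (fun k => G k (x k)) u (𝓝 (F xbar)) := by
    simpa using (hG.mono_left hul).add hFu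
  refine ge_of_tendsto (tendsto_finsetSum _ fun i _ =>
    (tendsto_const_nhds.sub (tendsto_pi_nhds.1 hu i)).inner (tendsto_pi_nhds.1 hGu i))
    (hxu.mono fun k hk => hk.2 y hy)

theorem LightTail.integrable_norm {Ξ : Set (Vec p)} {Q : Measure Ξ} {a : ℝ}
    (hQ : LightTail Q a) : Integrable (fun ξ : Ξ => ‖(ξ : Vec p)‖) Q := by
  refine hQ.2.mono' (by fun_prop) (ae_of_all _ fun ξ => ?_)
  rw [norm_norm]
  have h2 := Real.add_one_le_exp (‖(ξ : Vec p)‖ ^ a)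
  rcases le_total ‖(ξ : Vec p)‖ 1 with h1 | h1
  · have := Real.rpow_nonneg (norm_nonneg (ξ : Vec p)) a
    linarith
  · have := Real.self_le_rpow_of_one_le h1 hQ.1.le
    linarith

theorem LightTail.integrable_dist {Ξ : Set (Vec p)} {Q : Measure Ξ} [IsFiniteMeasure Q] {a : ℝ}
    (hQ : LightTail Q a) (z : Ξ) : Integrable (fun ξ => dist ξ z) Q := by
  refine (hQ.integrable_norm.add (integrable_const ‖(z : Vec p)‖)).mono' (by fun_prop)
    (ae_of_all _ fun ξ => ?_)
  rw [Real.norm_of_nonneg dist_nonneg, Subtype.dist_eq, dist_eq_norm]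
  exact norm_sub_le _ _

/-- On a sample path along which the empirical integrals of Lipschitz functions converge uniformly,
the pseudogradients of all distributions in shrinking Wasserstein balls around the empirical ones
approach the nominal pseudogradient, uniformly over the points `x K ∈ X`. -/
theorem tendsto_pseudogradient_sub {P : (i : Fin N) → Measure (Ξ i)}
    (hsmooth : SmoothCosts X h) (hconvex : ConvexGame X h) (hLip : LipschitzPartials X h L)
    (hP : ∀ i, FiniteExpectedCost X h i (P i))
    {ω : (i : Fin N) → ℕ → Ξ i}
    (hω : ∀ i, ∀ η > 0, ∀ᶠ k in atTop, ∀ (C : ℝ≥0) (f : Ξ i → Vec n), LipschitzWith C f →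
      ‖∫ ξ, f ξ ∂(empirical (ω i) k) - ∫ ξ, f ξ ∂(P i)‖ ≤ C * η)
    {r : Fin N → ℕ → ℝ} (hr : ∀ i, Tendsto (r i) atTop (𝓝 0))
    {S : Set (Fin N → ℕ)} {q : (Fin N → ℕ) → (i : Fin N) → Measure (Ξ i)}
    {x : (Fin N → ℕ) → Profile N n}
    (hq : ∀ K ∈ S, ∀ i, q K i ∈ wassersteinBall (empirical (ω i) (K i)) (r i (K i)))
    (hqfin : ∀ K ∈ S, ∀ i, FiniteExpectedCost X h i (q K i))
    (hx : ∀ K ∈ S, x K ∈ jointSet X) :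
    Tendsto (fun K => pseudogradient h (q K) (x K) - pseudogradient h P (x K))
      (atTop ⊓ 𝓟 S) (𝓝 0) := by
  refine tendsto_pi_nhds.2 fun i => Metric.tendsto_nhds.2 fun e he => ?_
  set C : ℝ≥0 := 1 + ∑ j, Real.nnabs (L i j) with hC
  have hC0 : (0 : ℝ) < C := by rw [hC]; positivity
  -- each of the two steps, from `q` to the empirical and on to the true distribution,
  -- costs `C * η`
  set η : ℝ := e / (4 * C) with hη
  have hη0 : 0 < η := by positivity
  have hK : Tendsto (fun K : Fin N → ℕ => K i) atTop atTop :=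
    tendsto_atTop.2 fun b => (eventually_ge_atTop fun _ => b).mono fun K hK => hK i
  filter_upwards [(hK.eventually (hω i η hη0)).filter_mono inf_le_left,
    (hK.eventually ((hr i).eventually_lt_const hη0)).filter_mono inf_le_left,
    (hK.eventually (eventually_ne_atTop 0)).filter_mono inf_le_left,
    mem_inf_of_right (mem_principal_self S)] with K h1 h2 h3 hKS
  have hf := lipschitzWith_costGradient hLip i (hx K hKS)
  obtain ⟨hint, hgrad⟩ :=
    pseudogradient_eq_integral hsmooth hconvex hLip (hqfin K hKS i) (hx K hKS)
  have h4 := h1 C _ hf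
  have h5 : ‖∫ ξ, costGradient h i (x K) ξ ∂(empirical (ω i) (K i))
      - ∫ ξ, costGradient h i (x K) ξ ∂(q K i)‖ ≤ C * η := by
    have h6 : ‖∫ ξ, costGradient h i (x K) ξ ∂(empirical (ω i) (K i))
        - ∫ ξ, costGradient h i (x K) ξ ∂(q K i)‖ₑ ≤ ENNReal.ofReal (C * η) := by
      refine (enorm_integral_sub_integral_le_mul_dW (by exact_mod_cast hC0.ne') hf
        (integrable_empirical _ h3 _) hint).trans ?_
      rw [ENNReal.ofReal_mul hC0.le, ENNReal.ofReal_coe_nnreal]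
      gcongr
      exact (hq K hKS i).2.trans (ENNReal.ofReal_le_ofReal h2.le)
    rwa [← ofReal_norm, ENNReal.ofReal_le_ofReal_iff (by positivity)] at h6
  rw [dist_eq_norm, Pi.sub_apply, Pi.zero_apply, sub_zero, hgrad,
    (pseudogradient_eq_integral hsmooth hconvex hLip (hP i) (hx K hKS)).2]
  rw [norm_sub_rev] at h5
  have h7 := norm_sub_le_norm_sub_add_norm_sub (∫ ξ, costGradient h i (x K) ξ ∂(q K i))
    (∫ ξ, costGradient h i (x K) ξ ∂(empirical (ω i) (K i)))
    (∫ ξ, costGradient h i (x K) ξ ∂(P i))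
  have h8 : C * η = e / 4 := by rw [hη]; field_simp
  linarith

end Game

end WDRGame

theorem mainTheorem2 {N n p : ℕ}
    -- the game: strategy sets, supports, costs, true distributions
    (X : Fin N → Set (WDRGame.Vec n)) (Ξ : Fin N → Set (WDRGame.Vec p))
    (h : WDRGame.Costs N n p Ξ)
    (P : (i : Fin N) → Measure (Ξ i)) [∀ i, IsProbabilityMeasure (P i)]
    (L : Fin N → Fin n → ℝ) (a : Fin N → ℝ)
    (hsmooth : WDRGame.SmoothCosts X h)
    (hconvex : WDRGame.ConvexGame X h)
    (htail : ∀ i, WDRGame.LightTail (P i) (a i))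
    (hLip : WDRGame.LipschitzPartials X h L)
    (hfinite : ∀ i, WDRGame.FiniteExpectedCost X h i (P i))
    (hcont : ContinuousOn (WDRGame.pseudogradient h P) (WDRGame.jointSet X))
    -- the confidence parameters and the radii
    (b c : Fin N → ℝ) (hb : ∀ i, 0 < b i) (hc : ∀ i, 0 < c i)
    (β : Fin N → ℕ → ℝ)
    (hβ : ∀ i, ∀ k, 1 ≤ k → β i k ∈ Set.Ioo (0 : ℝ) 1)
    (hβsum : ∀ i, Summable (β i))
    (hradius : ∀ i, Tendsto (fun k => WDRGame.radius p (a i) (b i) (c i) k (β i k)) atTop (𝓝 0))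
    -- the isolated solution of the nominal problem
    (xstar : WDRGame.Profile N n) (V : Set (WDRGame.Profile N n)) (hV : V ∈ 𝓝 xstar)
    (hisolated :
      WDRGame.SOL (WDRGame.jointSet X) (WDRGame.pseudogradient h P) ∩ V = {xstar}) :
    ∀ᵐ ω ∂(WDRGame.samplingLaw P),
      ∀ (S : Set (Fin N → ℕ)) (q : (Fin N → ℕ) → (i : Fin N) → Measure (Ξ i))
        (x : (Fin N → ℕ) → WDRGame.Profile N n),
        (∀ K₀, ∃ K ∈ S, K₀ ≤ K) →
        (∀ K ∈ S, ∀ i, q K i ∈ WDRGame.wassersteinBall (WDRGame.empirical (ω i) (K i))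
            (WDRGame.radius p (a i) (b i) (c i) (K i) (β i (K i)))) →
        (∀ K ∈ S, ∀ i, WDRGame.FiniteExpectedCost X h i (q K i)) →
        (∀ K ∈ S,
          x K ∈ WDRGame.SOL (WDRGame.jointSet X) (WDRGame.pseudogradient h (q K)) ∩ V) →
        (∃ xbar, MapClusterPt xbar (atTop ⊓ 𝓟 S) x) ∧
        (∀ xbar, MapClusterPt xbar (atTop ⊓ 𝓟 S) x →
          xbar ∈ WDRGame.SOL (WDRGame.jointSet X) (WDRGame.pseudogradient h P)) ∧
        (WDRGame.SOL (WDRGame.jointSet X) (WDRGame.pseudogradient h P) ∩ closure V = {xstar} →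
          Tendsto x (atTop ⊓ 𝓟 S) (𝓝 xstar)) := by

  have hω : ∀ᵐ ω ∂(WDRGame.samplingLaw P), ∀ i, ∀ η > 0, ∀ᶠ k in atTop,
      ∀ (C : NNReal) (f : Ξ i → WDRGame.Vec n), LipschitzWith C f →
        ‖∫ ξ, f ξ ∂(WDRGame.empirical (ω i) k) - ∫ ξ, f ξ ∂(P i)‖ ≤ C * η := by
    refine ae_all_iff.2 fun i => ?_
    obtain ⟨z⟩ := (P i).nonempty_of_neZero
    exact (measurePreserving_eval (fun i => Measure.infinitePi fun _ : ℕ => P i)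
      i).quasiMeasurePreserving.ae
        (WDRGame.ae_eventually_norm_integral_empirical_sub_le (WDRGame.Vec n)
          ((htail i).integrable_dist z))
  filter_upwards [hω] with ω hω S q x hS hq hqfin hx
  have hne : (atTop ⊓ 𝓟 S : Filter (Fin N → ℕ)).NeBot := by
    refine inf_principal_neBot_iff.2 fun U hU => ?_
    obtain ⟨K₀, hK₀⟩ := mem_atTop_sets.1 hU
    obtain ⟨K, hKS, hK⟩ := hS K₀
    exact ⟨K, hK₀ K hK, hKS⟩
  have hXc : IsCompact (WDRGame.jointSet X) :=
    WDRGame.isCompact_jointSet fun i => (hconvex.1 i).1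
  have hSmem : ∀ᶠ K in atTop ⊓ 𝓟 S, K ∈ S := mem_inf_of_right (mem_principal_self S)
  have hxX : ∀ᶠ K in atTop ⊓ 𝓟 S, x K ∈ WDRGame.jointSet X :=
    hSmem.mono fun K hK => (hx K hK).1.1
  have hG := WDRGame.tendsto_pseudogradient_sub hsmooth hconvex hLip hfinite hω hradius hq hqfin
    fun K hK => (hx K hK).1.1
  have hsol : ∀ xbar, MapClusterPt xbar (atTop ⊓ 𝓟 S) x →
      xbar ∈ WDRGame.SOL (WDRGame.jointSet X) (WDRGame.pseudogradient h P) := fun xbar hbar =>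
    WDRGame.mem_SOL_of_mapClusterPt hXc.isClosed hcont
      (hSmem.mono fun K hK => (hx K hK).1) hG hbar
  refine ⟨?_, hsol, fun hunique => ?_⟩
  · obtain ⟨xbar, -, hbar⟩ := hXc.exists_mapClusterPt (tendsto_principal.2 hxX)
    exact ⟨xbar, hbar⟩
  · refine hXc.tendsto_nhds_of_unique_mapClusterPt hxX fun xbar _ hbar => ?_
    have hV : xbar ∈ closure V :=
      mem_closure_iff_clusterPt.2 (ClusterPt.mono (show ClusterPt xbar (map x _) from hbar)
        (tendsto_principal.2 (hSmem.mono fun K hK => (hx K hK).2)))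
    exact hunique.subset ⟨hsol xbar hbar, hV⟩
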